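/- A sequence of polynomials $K_0=1,K_1,K_2,\ldots$ in $\mathbb{Q}[p_1,p_2,\ldots]$, with $K_k$ homogeneous of weight $k$ where $p_i$ has weight $i$, is called multiplicative if $1+\sum_{i\ge 1} p_i z^i=\big(1+\sum_{i\ge 1} p_i'z^i\big)\big(1+\sum_{i\ge 1} p_i''z^i\big)$ implies $\sum_k K_k(p)z^k=\big(\sum_k K_k(p')z^k\big)\big(\sum_k K_k(p'')z^k\big)$ (for $p', p''$ in any commutative $\mathbb{Q}$-algebra); its characteristic power series is $\sum_k K_k(1,0,\ldots,0)z^k$. There is a unique multiplicative sequence $\hat{A}_0,\hat{A}_1,\hat{A}_2,\ldots$ with characteristic power series $$\frac{\sqrt z/2}{\sinh(\sqrt z/2)},$$ the sequence of $\hat{A}$-polynomials. Write $\hat{A}_k=\sum a_{j_1,\ldots,j_r}\,p_{j_1}\cdots p_{j_r}$, where the sum is over all partitions $(j_1,\ldots,j_r)$ of $k$, i.e., sequences of integers $j_1\ge\cdots\ge j_r\ge 1$ with $j_1+\cdots+j_r=k$. For real $s_1,\ldots,s_r>1$ put $$S(s_1,\ldots,s_r)=\sum_{n_1\ge\cdots\ge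 n_r\ge 1}\frac{1}{n_1^{s_1}\cdots n_r^{s_r}},\qquad S^\Sigma(s_1,\ldots,s_r)=\sum_{\sigma\in\Sigma_r}S(s_{\sigma_1},\ldots,s_{\sigma_r}),$$ where $\Sigma_r$ is the symmetric group. **Theorem.** For every partition $(j_1,\ldots,j_r)$ of $k$, the series defining $S^\Sigma(2j_1,\ldots,2j_r)$ converge and $$a_{j_1,\ldots,j_r}=\frac{(-1)^r}{\alpha_1!\cdots\alpha_k!}\,\frac{1}{(2\pi)^{2k}}\,S^\Sigma(2j_1,\ldots,2j_r),$$ where $\alpha_\ell$ counts how many of $j_1,\ldots,j_r$ are equal to $\ell$. In particular, $a_{j_1,\ldots,j_r}$ is negative if $r$ is odd and positive if $r$ is even. -/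

import Mathlib

namespace AHat

/-- The value of a sequence of polynomials `K_0, K_1, K_2, …` in the indeterminates
`p_1, p_2, …` (indexed by `ℕ+`) on a formal power series `P = 1 + p_1 z + p_2 z ^ 2 + ⋯`:
the power series `∑ K_k(p_1, …, p_k) z ^ k`. -/
noncomputable def seriesValue (K : ℕ → MvPolynomial ℕ+ ℚ) {R : Type} [CommRing R] [Algebra ℚ R]
    (P : PowerSeries R) : PowerSeries R :=
  PowerSeries.mk fun k =>
    MvPolynomial.aeval (fun i : ℕ+ => PowerSeries.coeff (i : ℕ) P) (K k)

/-- A multiplicative sequence of polynomials with rational coefficients: `K_0 = 1`, each `K_k` is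
homogeneous of weight `k` where `p_i` has weight `i` (so it is a linear combination of the
`p_{j_1} ⋯ p_{j_r}` with `(j_1, …, j_r)` a partition of `k`), and
`1 + p_1 z + ⋯ = (1 + p'_1 z + ⋯) (1 + p''_1 z + ⋯)` implies
`∑ K_k(p) z ^ k = (∑ K_k(p') z ^ k) (∑ K_k(p'') z ^ k)`. -/
structure IsMultiplicativeSequence (K : ℕ → MvPolynomial ℕ+ ℚ) : Prop where
  zero : K 0 = 1
  homogeneous : ∀ k, MvPolynomial.IsWeightedHomogeneous (fun i : ℕ+ => (i : ℕ)) (K k) k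
  mul : ∀ (R : Type) [CommRing R] [Algebra ℚ R] (P P' : PowerSeries R),
    PowerSeries.constantCoeff P = 1 → PowerSeries.constantCoeff P' = 1 →
      seriesValue K (P * P') = seriesValue K P * seriesValue K P'

/-- The characteristic power series `∑ K_k(1, 0, …, 0) z ^ k`, the value on `1 + z`; its
coefficient at `z ^ k` is the coefficient of `p_1 ^ k` in `K_k`. -/
noncomputable def charSeries (K : ℕ → MvPolynomial ℕ+ ℚ) : PowerSeries ℚ :=
  seriesValue K (1 + PowerSeries.X)

/-- The formal power series `(√z / 2) / sinh (√z / 2)`, that is, the inverse of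
`sinh (√z / 2) / (√z / 2) = ∑ z ^ n / (4 ^ n * (2 n + 1)!)`. -/
noncomputable def aHatSeries : PowerSeries ℚ :=
  (PowerSeries.mk fun n => 1 / ((4 : ℚ) ^ n * (Nat.factorial (2 * n + 1) : ℚ)))⁻¹

/-- `A_0, A_1, A_2, …` is the sequence of `Â`-polynomials. -/
def IsAHatSequence (A : ℕ → MvPolynomial ℕ+ ℚ) : Prop :=
  IsMultiplicativeSequence A ∧ charSeries A = aHatSeries

/-- The coefficient of `p_{j_1} ⋯ p_{j_r}` in a polynomial. -/
noncomputable def monomialCoeff (F : MvPolynomial ℕ+ ℚ) {r : ℕ} (j : Fin r → ℕ+) : ℚ :=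
  MvPolynomial.coeff (∑ i, Finsupp.single (j i) 1) F

/-- How many of `j_1, …, j_r` are equal to `l`. -/
def multiplicity {r : ℕ} (j : Fin r → ℕ+) (l : ℕ) : ℕ :=
  (Finset.univ.filter fun i => (j i : ℕ) = l).card

/-- The term `1 / (n_1 ^ s_1 ⋯ n_r ^ s_r)` at a sequence of integers
`n_1 ≥ n_2 ≥ ⋯ ≥ n_r ≥ 1`. -/
noncomputable def starTerm {r : ℕ} (s : Fin r → ℝ) (n : {n : Fin r → ℕ+ // Antitone n}) : ℝ :=
  1 / ∏ i, ((n.1 i : ℕ) : ℝ) ^ s i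

/-- `S(s_1, …, s_r)`, the sum of `1 / (n_1 ^ s_1 ⋯ n_r ^ s_r)` over `n_1 ≥ ⋯ ≥ n_r ≥ 1`. -/
noncomputable def starSum {r : ℕ} (s : Fin r → ℝ) : ℝ :=
  ∑' n, starTerm s n

/-- The symmetrization of `S` over all permutations of the arguments. -/
noncomputable def symStarSum {r : ℕ} (s : Fin r → ℝ) : ℝ :=
  ∑ σ : Equiv.Perm (Fin r), starSum fun i => s (σ i)

end AHat

/-! Put x_n = 1 / (2πn)². Euler's product says that sinh(√z/2)/(√z/2) = ∏ (1 + x_n z). If P = 1 +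
p_1 z + ⋯ = ∏ (1 + t z) over finitely many t, multiplicativity makes ∑ Â_k(p) z^k the inverse of ∏_t
∏_n (1 + x_n t z) = ∏_n P(x_n z). With u_n = P(x_n z) - 1 this inverse is ∑ (-1)^r h_r(u), where the
complete symmetric sum h_r runs over n_1 ≥ ⋯ ≥ n_r; that is where S comes from. The coefficient of
z^k in h_r(u) is a sum over compositions c of k of p_{c_1} ⋯ p_{c_r} S(2c_1, …, 2c_r) / (2π)^{2k}.
Collecting the rearrangements of one partition, each produced by α_1! ⋯ α_k! permutations, gives the
formula; the sign follows since S > 0.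

Testing on products of linear factors over ℂ suffices (`eq_of_eval_linProd_eq`), which also yields
uniqueness of the sequence. Existence comes from a differential equation for the value
(`seriesValue_multSeq_equation`). The infinite product is handled with n ≤ N and modulo z^{k+1}
(`X_pow_dvd_alternatingSum_mul_sub_one`), then N → ∞ in each coefficient (`sinhLimit_eq`,
`tendsto_starPartial`); `eval_map_starPoly_linProd` joins the two. -/

namespace AHat

open PowerSeries

/-! ### Logarithmic derivatives and the equation z F' = F H. -/

section LogDerivative

variable {R : Type*} [CommRing R]

/-- `z P' / P` for a power series `P` with constant coefficient `1`. -/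
noncomputable def logDeriv (P : PowerSeries R) : PowerSeries R :=
  X * derivative R P * invOfUnit P 1

theorem logDeriv_mul_self {P : PowerSeries R} (hP : constantCoeff P = 1) :
    logDeriv P * P = X * derivative R P := by
  rw [logDeriv, mul_assoc, mul_comm _ P, mul_invOfUnit P 1 (by simpa using hP), mul_one]

theorem logDeriv_unique {P L : PowerSeries R} (hP : constantCoeff P = 1)
    (h : L * P = X * derivative R P) : L = logDeriv P := by
  have h1 := mul_invOfUnit P 1 (by simpa using hP)
  rw [logDeriv, ← h, mul_assoc, h1, mul_one]

theorem logDeriv_mul {P P' : PowerSeries R} (hP : constantCoeff P = 1)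
    (hP' : constantCoeff P' = 1) : logDeriv (P * P') = logDeriv P + logDeriv P' := by
  symm
  refine logDeriv_unique (by simp [hP, hP']) ?_
  have h1 := logDeriv_mul_self hP
  have h2 := logDeriv_mul_self hP'
  rw [Derivation.leibniz, smul_eq_mul, smul_eq_mul]
  linear_combination P' * h1 + P * h2

theorem derivative_map {S : Type*} [CommRing S] (f : R →+* S) (P : PowerSeries R) :
    derivative S (P.map f) = (derivative R P).map f := by
  ext n
  simp [coeff_derivative]

theorem map_logDeriv {S : Type*} [CommRing S] (f : R →+* S) {P : PowerSeries R}
    (hP : constantCoeff P = 1) : (logDeriv P).map f = logDeriv (P.map f) := by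
  refine logDeriv_unique ?_ ?_
  · rw [← coeff_zero_eq_constantCoeff_apply, coeff_map, coeff_zero_eq_constantCoeff_apply, hP,
      map_one]
  · rw [← map_mul, logDeriv_mul_self hP, map_mul, map_X, derivative_map]

theorem constantCoeff_logDeriv (P : PowerSeries R) : constantCoeff (logDeriv P) = 0 := by
  simp [logDeriv]

end LogDerivative

section Equation

variable {R : Type*} [CommRing R] [Algebra ℚ R]

/-- Since H(0) = 0, the equation reads (n + 1) F_{n+1} = ∑_{i ≤ n} F_i H_{n+1-i}, and n + 1 is
invertible in a ℚ-algebra. -/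
theorem eq_of_X_mul_derivative_eq {H F G : PowerSeries R} (hH : constantCoeff H = 0)
    (h0 : constantCoeff F = constantCoeff G) (hF : X * derivative R F = F * H)
    (hG : X * derivative R G = G * H) : F = G := by
  ext n
  induction n using Nat.strong_induction_on with
  | _ n ih =>
    rcases n with _ | n
    · simpa using h0
    have h1 := congrArg (coeff (n + 1)) hF
    have h2 := congrArg (coeff (n + 1)) hG
    rw [coeff_succ_X_mul, coeff_derivative, coeff_mul,
      Finset.Nat.sum_antidiagonal_eq_sum_range_succ (fun i j => coeff i F * coeff j H),
      Finset.sum_range_succ] at h1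
    rw [coeff_succ_X_mul, coeff_derivative, coeff_mul,
      Finset.Nat.sum_antidiagonal_eq_sum_range_succ (fun i j => coeff i G * coeff j H),
      Finset.sum_range_succ] at h2
    rw [Nat.sub_self, coeff_zero_eq_constantCoeff_apply, hH, mul_zero, add_zero] at h1 h2
    have h3 : coeff (n + 1) F * ((n : R) + 1) = coeff (n + 1) G * ((n : R) + 1) := by
      rw [h1, h2]
      exact Finset.sum_congr rfl fun i hi => by rw [ih i (Finset.mem_range.1 hi)]
    have h4 : ((n : R) + 1) * algebraMap ℚ R (1 / ((n : ℚ) + 1)) = 1 := by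
      have : ((n : R) + 1) = algebraMap ℚ R ((n : ℚ) + 1) := by simp
      rw [this, ← map_mul, mul_one_div_cancel (by positivity), map_one]
    calc coeff (n + 1) F
        = coeff (n + 1) F * ((n : R) + 1) * algebraMap ℚ R (1 / ((n : ℚ) + 1)) := by
          rw [mul_assoc, h4, mul_one]
      _ = coeff (n + 1) G := by rw [h3, mul_assoc, h4, mul_one]

/-- The coefficients of the solution of `z F' = F H`, `F(0) = 1`. -/
noncomputable def solCoeff (H : PowerSeries R) : ℕ → R
  | 0 => 1
  | k + 1 => (1 / ((k : ℚ) + 1)) • ∑ i : Fin (k + 1), solCoeff H i * coeff (k + 1 - i) H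

theorem X_mul_derivative_solCoeff {H : PowerSeries R} (hH : constantCoeff H = 0) :
    X * derivative R (mk (solCoeff H)) = mk (solCoeff H) * H := by
  ext n
  rcases n with _ | n
  · simp [hH]
  rw [coeff_succ_X_mul, coeff_derivative, coeff_mul,
    Finset.Nat.sum_antidiagonal_eq_sum_range_succ
      (fun i j => coeff i (mk (solCoeff H)) * coeff j H), Finset.sum_range_succ, Nat.sub_self,
    coeff_zero_eq_constantCoeff_apply, hH, mul_zero, add_zero]
  simp only [coeff_mk]
  rw [solCoeff, Finset.sum_range fun i => solCoeff H i * coeff (n + 1 - i) H]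
  have : ((n : R) + 1) = algebraMap ℚ R ((n : ℚ) + 1) := by simp
  rw [this, mul_comm, ← Algebra.smul_def, smul_smul, mul_one_div_cancel (by positivity), one_smul]

end Equation

/-! ### Existence of a multiplicative sequence with given characteristic series. -/

section Existence

/-- The generic power series `1 + p_1 z + p_2 z ^ 2 + ⋯`. -/
noncomputable def genericSeries : PowerSeries (MvPolynomial ℕ+ ℚ) :=
  mk fun n => if h : 0 < n then MvPolynomial.X ⟨n, h⟩ else 1

/-- The coefficientwise product of a power series over a `ℚ`-algebra with one over `ℚ`. -/
noncomputable def hadamard {R : Type*} [CommRing R] [Algebra ℚ R] (c : PowerSeries ℚ)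
    (L : PowerSeries R) : PowerSeries R :=
  mk fun n => algebraMap ℚ R (coeff n c) * coeff n L

/-- The coefficients `(-1) ^ (n + 1) d_n`, where `z Q' / Q = ∑ d_n z ^ n`. -/
noncomputable def signedLogDeriv (Q : PowerSeries ℚ) : PowerSeries ℚ :=
  mk fun n => (-1) ^ (n + 1) * coeff n (logDeriv Q)

/-- The multiplicative sequence with characteristic power series `Q`. -/
noncomputable def multSeq (Q : PowerSeries ℚ) : ℕ → MvPolynomial ℕ+ ℚ :=
  solCoeff (hadamard (signedLogDeriv Q) (logDeriv genericSeries))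

theorem constantCoeff_genericSeries : constantCoeff genericSeries = 1 := by
  rw [← coeff_zero_eq_constantCoeff_apply, genericSeries, coeff_mk]
  simp

theorem constantCoeff_hadamard {R : Type*} [CommRing R] [Algebra ℚ R] (c : PowerSeries ℚ)
    {L : PowerSeries R} (hL : constantCoeff L = 0) : constantCoeff (hadamard c L) = 0 := by
  rw [← coeff_zero_eq_constantCoeff_apply, hadamard, coeff_mk, coeff_zero_eq_constantCoeff_apply,
    coeff_zero_eq_constantCoeff_apply, hL, mul_zero]

theorem map_hadamard {R S : Type*} [CommRing R] [Algebra ℚ R] [CommRing S] [Algebra ℚ S]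
    (f : R →ₐ[ℚ] S) (c : PowerSeries ℚ) (L : PowerSeries R) :
    (hadamard c L).map f.toRingHom = hadamard c (L.map f.toRingHom) := by
  ext n
  simp [hadamard]

theorem hadamard_add {R : Type*} [CommRing R] [Algebra ℚ R] (c : PowerSeries ℚ)
    (L L' : PowerSeries R) : hadamard c (L + L') = hadamard c L + hadamard c L' := by
  ext n
  simp [hadamard, mul_add]

variable {R : Type} [CommRing R] [Algebra ℚ R]

theorem seriesValue_eq_map (K : ℕ → MvPolynomial ℕ+ ℚ) (P : PowerSeries R) :
    seriesValue K P = (mk K).map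
      (MvPolynomial.aeval (R := ℚ) fun i : ℕ+ => coeff (i : ℕ) P).toRingHom := by
  ext n
  simp [seriesValue]

theorem map_genericSeries {P : PowerSeries R} (hP : constantCoeff P = 1) :
    genericSeries.map (MvPolynomial.aeval (R := ℚ) fun i : ℕ+ => coeff (i : ℕ) P).toRingHom
      = P := by
  ext n
  rw [coeff_map, genericSeries, coeff_mk]
  rcases n with _ | n
  · simp [hP]
  · rw [dif_pos n.succ_pos]
    exact MvPolynomial.aeval_X _ _

/-- If P = ∏ (1 + t z), the value should be ∏ Q(t z), with logarithmic derivative ∑ d_n s_n z^n for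
the power sums s_n of the t. As z P'/P = ∑ (-1)^{n+1} s_n z^n, the signed coefficientwise product
expresses this without the roots. The equation holds for the generic series by construction and is
specialised to P. -/
theorem seriesValue_multSeq_equation (Q : PowerSeries ℚ) {P : PowerSeries R}
    (hP : constantCoeff P = 1) :
    X * derivative R (seriesValue (multSeq Q) P) =
      seriesValue (multSeq Q) P * hadamard (signedLogDeriv Q) (logDeriv P) := by
  rw [seriesValue_eq_map, derivative_map, ← map_X (MvPolynomial.aeval (R := ℚ)
    fun i : ℕ+ => coeff (i : ℕ) P).toRingHom, ← map_mul, multSeq, X_mul_derivative_solCoeff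
    (constantCoeff_hadamard _ (constantCoeff_logDeriv _)), map_mul, map_hadamard,
    map_logDeriv _ constantCoeff_genericSeries, map_genericSeries hP]

theorem constantCoeff_seriesValue_multSeq (Q : PowerSeries ℚ) (P : PowerSeries R) :
    constantCoeff (seriesValue (multSeq Q) P) = 1 := by
  rw [← coeff_zero_eq_constantCoeff_apply, seriesValue, coeff_mk, multSeq, solCoeff, map_one]

/-- Logarithmic derivatives turn products into sums and the coefficientwise product is additive, so
both sides solve the same equation with constant term 1. -/
theorem seriesValue_multSeq_mul (Q : PowerSeries ℚ) {P P' : PowerSeries R}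
    (hP : constantCoeff P = 1) (hP' : constantCoeff P' = 1) :
    seriesValue (multSeq Q) (P * P') = seriesValue (multSeq Q) P * seriesValue (multSeq Q) P' := by
  refine eq_of_X_mul_derivative_eq
    (constantCoeff_hadamard (signedLogDeriv Q) (constantCoeff_logDeriv (P * P'))) ?_
    (seriesValue_multSeq_equation Q (by simp [hP, hP'])) ?_
  · simp only [map_mul, constantCoeff_seriesValue_multSeq, mul_one]
  · have h1 := seriesValue_multSeq_equation Q hP
    have h2 := seriesValue_multSeq_equation Q hP'
    rw [logDeriv_mul hP hP', hadamard_add, Derivation.leibniz, smul_eq_mul, smul_eq_mul]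
    linear_combination seriesValue (multSeq Q) P' * h1 + seriesValue (multSeq Q) P * h2

theorem logDeriv_one_add_X :
    logDeriv (1 + X : PowerSeries ℚ) = mk fun n => if n = 0 then 0 else (-1) ^ (n + 1) := by
  symm
  refine logDeriv_unique (by simp) ?_
  ext n
  rw [mul_add, mul_one]
  rcases n with _ | _ | n
  · simp
  · simp [coeff_succ_mul_X]
  · simp [coeff_succ_mul_X, coeff_X, pow_succ]

theorem charSeries_multSeq {Q : PowerSeries ℚ} (hQ : constantCoeff Q = 1) :
    charSeries (multSeq Q) = Q := by
  have hP : constantCoeff (1 + X : PowerSeries ℚ) = 1 := by simp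
  have h := seriesValue_multSeq_equation Q hP
  have hH : hadamard (signedLogDeriv Q) (logDeriv (1 + X : PowerSeries ℚ)) = logDeriv Q := by
    ext n
    rw [logDeriv_one_add_X, hadamard, signedLogDeriv]
    rcases n with _ | n
    · simp [constantCoeff_logDeriv]
    · simp only [coeff_mk, Algebra.algebraMap_self, RingHom.id_apply]
      rw [if_neg n.succ_ne_zero, mul_right_comm, ← mul_pow]
      simp
  rw [hH] at h
  refine eq_of_X_mul_derivative_eq (constantCoeff_logDeriv Q) ?_ h ?_
  · rw [charSeries, constantCoeff_seriesValue_multSeq, hQ]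
  · rw [← logDeriv_mul_self hQ, mul_comm]

theorem isWeightedHomogeneous_coeff_genericSeries (n : ℕ) :
    (coeff n genericSeries).IsWeightedHomogeneous (fun i : ℕ+ => (i : ℕ)) n := by
  rw [genericSeries, coeff_mk]
  split_ifs with h
  · exact MvPolynomial.isWeightedHomogeneous_X ℚ (fun i : ℕ+ => (i : ℕ)) ⟨n, h⟩
  · obtain rfl : n = 0 := by omega
    exact MvPolynomial.isWeightedHomogeneous_one _ _

theorem isWeightedHomogeneous_coeff_logDeriv (n : ℕ) :
    (coeff n (logDeriv genericSeries)).IsWeightedHomogeneous (fun i : ℕ+ => (i : ℕ)) n := by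
  induction n using Nat.strong_induction_on with
  | _ n ih =>
    rcases n with _ | n
    · rw [coeff_zero_eq_constantCoeff_apply, constantCoeff_logDeriv]
      exact MvPolynomial.isWeightedHomogeneous_zero _ _ _
    have h := congrArg (coeff (n + 1)) (logDeriv_mul_self constantCoeff_genericSeries)
    rw [coeff_succ_X_mul, coeff_derivative, coeff_mul,
      Finset.Nat.sum_antidiagonal_eq_sum_range_succ
        (fun i j => coeff i (logDeriv genericSeries) * coeff j genericSeries),
      Finset.sum_range_succ, Nat.sub_self,
      coeff_zero_eq_constantCoeff_apply genericSeries, constantCoeff_genericSeries, mul_one] at h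
    rw [eq_sub_of_add_eq' h]
    refine MvPolynomial.IsWeightedHomogeneous.sub ?_ ?_
    · have := (isWeightedHomogeneous_coeff_genericSeries (n + 1)).C_mul ((n : ℚ) + 1)
      rw [mul_comm]
      simpa using this
    · refine MvPolynomial.IsWeightedHomogeneous.sum _ _ _ fun i hi => ?_
      have hi := Finset.mem_range.1 hi
      have := (ih i hi).mul (isWeightedHomogeneous_coeff_genericSeries (n + 1 - i))
      rwa [Nat.add_sub_cancel' hi.le] at this

theorem isWeightedHomogeneous_multSeq (Q : PowerSeries ℚ) (n : ℕ) :
    (multSeq Q n).IsWeightedHomogeneous (fun i : ℕ+ => (i : ℕ)) n := by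
  induction n using Nat.strong_induction_on with
  | _ n ih =>
    rcases n with _ | n
    · rw [multSeq, solCoeff]
      exact MvPolynomial.isWeightedHomogeneous_one _ _
    rw [multSeq, solCoeff, MvPolynomial.smul_eq_C_mul]
    refine MvPolynomial.IsWeightedHomogeneous.C_mul
      (MvPolynomial.IsWeightedHomogeneous.sum _ _ _ fun i _ => ?_) _
    rw [hadamard, coeff_mk, MvPolynomial.algebraMap_eq]
    have := (ih i i.2).mul ((isWeightedHomogeneous_coeff_logDeriv (n + 1 - i)).C_mul
      (coeff (n + 1 - i) (signedLogDeriv Q)))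
    rwa [Nat.add_sub_cancel' i.2.le] at this

theorem isMultiplicativeSequence_multSeq (Q : PowerSeries ℚ) :
    IsMultiplicativeSequence (multSeq Q) where
  zero := by rw [multSeq, solCoeff]
  homogeneous := isWeightedHomogeneous_multSeq Q
  mul _ _ _ _ _ hP hP' := seriesValue_multSeq_mul Q hP hP'

end Existence

end AHat

/-! ### Products of linear factors and uniqueness of the sequence. -/

namespace AHat

open PowerSeries

/-- A complex polynomial with constant coefficient `1` is a product of factors `1 + t z`. -/
theorem exists_multiset_prod_eq (q : Polynomial ℂ) (hq : q.coeff 0 = 1) :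
    ∃ t : Multiset ℂ, (t.map fun a => 1 + Polynomial.C a * Polynomial.X).prod = q := by
  have hs := IsAlgClosed.splits q
  have hne : q ≠ 0 := by rintro rfl; simp at hq
  -- A root a is nonzero and contributes X - a = -a (1 - a⁻¹ X); the factors -a cancel the leading
  -- coefficient.
  refine ⟨q.roots.map fun a => -a⁻¹, ?_⟩
  have h0 : ∀ a ∈ q.roots, a ≠ 0 := by
    rintro a ha rfl
    have := (Polynomial.mem_roots hne).1 ha
    rw [Polynomial.IsRoot.def, ← Polynomial.coeff_zero_eq_eval_zero, hq] at this
    exact one_ne_zero this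
  have h1 := hs.eq_prod_roots
  have h2 : (q.roots.map fun a => Polynomial.X - Polynomial.C a).prod =
      Polynomial.C (q.roots.map fun a => -a).prod *
        (q.roots.map fun a => 1 + Polynomial.C (-a⁻¹) * Polynomial.X).prod := by
    rw [map_multiset_prod, Multiset.map_map, ← Multiset.prod_map_mul]
    congr 1
    refine Multiset.map_congr rfl fun a ha => ?_
    have : Polynomial.C a * Polynomial.C a⁻¹ = 1 := by
      rw [← Polynomial.C_mul, mul_inv_cancel₀ (h0 a ha), Polynomial.C_1]
    simp only [Function.comp_apply, map_neg]
    linear_combination (-Polynomial.X) * this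
  have h3 : q.leadingCoeff * (q.roots.map fun a => -a).prod = 1 := by
    have := congrArg (Polynomial.eval 0) h1
    rw [← Polynomial.coeff_zero_eq_eval_zero, hq, Polynomial.eval_mul, Polynomial.eval_C,
      Polynomial.eval_multiset_prod, Multiset.map_map] at this
    simpa using this.symm
  rw [Multiset.map_map]
  conv_rhs => rw [h1, h2, ← mul_assoc, ← Polynomial.C_mul, h3, Polynomial.C_1, one_mul]
  rfl

/-- The power series `∏ (1 + t z)`, the product being over a multiset. -/
noncomputable def linProd (t : Multiset ℂ) : PowerSeries ℂ :=
  (t.map fun a => 1 + C a * X).prod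

theorem constantCoeff_linProd (t : Multiset ℂ) : constantCoeff (linProd t) = 1 := by
  rw [linProd, map_multiset_prod, Multiset.map_map]
  simp

theorem isWeightedHomogeneous_map {R S : Type*} [CommRing R] [CommRing S] (f : R →+* S)
    {F : MvPolynomial ℕ+ R} {k : ℕ} (hF : F.IsWeightedHomogeneous (fun i : ℕ+ => (i : ℕ)) k) :
    (F.map f).IsWeightedHomogeneous (fun i : ℕ+ => (i : ℕ)) k := by
  intro d hd
  refine hF fun h0 => hd ?_
  rw [MvPolynomial.coeff_map, h0, map_zero]

/-- A variable p_i with i > k would already exceed the weight k. -/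
theorem eval_eq_of_isWeightedHomogeneous {R : Type*} [CommRing R] {F : MvPolynomial ℕ+ R} {k : ℕ}
    (hF : F.IsWeightedHomogeneous (fun i : ℕ+ => (i : ℕ)) k) {p q : ℕ+ → R}
    (h : ∀ i : ℕ+, (i : ℕ) ≤ k → p i = q i) : MvPolynomial.eval p F = MvPolynomial.eval q F := by
  refine MvPolynomial.eval₂Hom_congr' rfl (fun i hi _ => h i ?_) rfl
  obtain ⟨d, hd, hid⟩ := (MvPolynomial.mem_vars_iff_mem_support i).1 hi
  have := hF (MvPolynomial.mem_support_iff.1 hd)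
  rw [← this, Finsupp.weight_apply, Finsupp.sum]
  refine le_trans ?_ (Finset.single_le_sum (f := fun j => d j • (j : ℕ)) (fun _ _ => Nat.zero_le _)
    hid)
  exact Nat.le_mul_of_pos_left _ (Nat.pos_of_ne_zero (Finsupp.mem_support_iff.1 hid))

/-- A weighted homogeneous polynomial is determined by its values on products of factors
`1 + t z`. -/
theorem eq_of_eval_linProd_eq {F G : MvPolynomial ℕ+ ℂ} {k : ℕ}
    (hF : F.IsWeightedHomogeneous (fun i : ℕ+ => (i : ℕ)) k)
    (hG : G.IsWeightedHomogeneous (fun i : ℕ+ => (i : ℕ)) k)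
    (h : ∀ t : Multiset ℂ, MvPolynomial.eval (fun i : ℕ+ => coeff (i : ℕ) (linProd t)) F =
      MvPolynomial.eval (fun i : ℕ+ => coeff (i : ℕ) (linProd t)) G) : F = G := by
  refine MvPolynomial.funext fun p => ?_
  let s : PowerSeries ℂ := mk fun n => if h : 0 < n then p ⟨n, h⟩ else 1
  -- Cutting off after degree k leaves a polynomial, which factors; weight k does not see the lost
  -- coefficients.
  obtain ⟨t, ht⟩ := exists_multiset_prod_eq (trunc (k + 1) s) (by simp [coeff_trunc, s])
  have hp : ∀ i : ℕ+, (i : ℕ) ≤ k → p i = coeff (i : ℕ) (linProd t) := by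
    intro i hi
    have : linProd t = ((trunc (k + 1) s : Polynomial ℂ) : PowerSeries ℂ) := by
      rw [← ht, linProd, ← Polynomial.coeToPowerSeries.ringHom_apply, map_multiset_prod,
        Multiset.map_map]
      simp [Function.comp_def]
    rw [this, Polynomial.coeff_coe, coeff_trunc, if_pos (by omega), coeff_mk, dif_pos i.pos]
    rfl
  rw [eval_eq_of_isWeightedHomogeneous hF hp, eval_eq_of_isWeightedHomogeneous hG hp, h t]

theorem eval_pow_mul_of_isWeightedHomogeneous {R : Type*} [CommRing R] {F : MvPolynomial ℕ+ R}
    {k : ℕ} (hF : F.IsWeightedHomogeneous (fun i : ℕ+ => (i : ℕ)) k) (a : R) (p : ℕ+ → R) :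
    MvPolynomial.eval (fun i : ℕ+ => a ^ (i : ℕ) * p i) F = a ^ k * MvPolynomial.eval p F := by
  rw [MvPolynomial.eval_eq, MvPolynomial.eval_eq, Finset.mul_sum]
  refine Finset.sum_congr rfl fun d hd => ?_
  have := hF (MvPolynomial.mem_support_iff.1 hd)
  rw [Finsupp.weight_apply, Finsupp.sum] at this
  simp_rw [mul_pow, ← pow_mul]
  rw [Finset.prod_mul_distrib, Finset.prod_pow_eq_pow_sum, ← this]
  simp_rw [smul_eq_mul, mul_comm]
  ring

theorem eval_map_eq_coeff_seriesValue (K : ℕ → MvPolynomial ℕ+ ℚ) (P : PowerSeries ℂ) (k : ℕ) :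
    MvPolynomial.eval (fun i : ℕ+ => coeff (i : ℕ) P) ((K k).map (algebraMap ℚ ℂ)) =
      coeff k (seriesValue K P) := by
  rw [seriesValue, coeff_mk, MvPolynomial.eval_map, MvPolynomial.aeval_def]

theorem seriesValue_rescale {K : ℕ → MvPolynomial ℕ+ ℚ} (hK : IsMultiplicativeSequence K)
    (a : ℂ) (P : PowerSeries ℂ) : seriesValue K (rescale a P) = rescale a (seriesValue K P) := by
  ext k
  rw [coeff_rescale, ← eval_map_eq_coeff_seriesValue, ← eval_map_eq_coeff_seriesValue,
    ← eval_pow_mul_of_isWeightedHomogeneous (isWeightedHomogeneous_map _ (hK.homogeneous k))]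
  simp_rw [coeff_rescale]

theorem seriesValue_map (K : ℕ → MvPolynomial ℕ+ ℚ) (P : PowerSeries ℚ) :
    seriesValue K (P.map (algebraMap ℚ ℂ)) = (seriesValue K P).map (algebraMap ℚ ℂ) := by
  ext k
  rw [coeff_map, seriesValue, seriesValue, coeff_mk, coeff_mk, ← MvPolynomial.aeval_algebraMap_apply]
  rfl

theorem seriesValue_one_add_C_mul_X {K : ℕ → MvPolynomial ℕ+ ℚ} (hK : IsMultiplicativeSequence K)
    (a : ℂ) :
    seriesValue K (1 + C a * X) = rescale a ((charSeries K).map (algebraMap ℚ ℂ)) := by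
  rw [charSeries, ← seriesValue_map, ← seriesValue_rescale hK]
  congr 1
  simp [rescale_X]

theorem seriesValue_one {K : ℕ → MvPolynomial ℕ+ ℚ} (hK : IsMultiplicativeSequence K) :
    seriesValue K (1 : PowerSeries ℂ) = 1 := by
  have h := hK.mul ℂ 1 1 (by simp) (by simp)
  rw [mul_one] at h
  -- The value is idempotent in a domain, and nonzero because its constant coefficient is K_0 = 1.
  refine (mul_eq_left₀ fun h0 => ?_).1 h.symm
  have h1 := congrArg (coeff 0) h0
  rw [seriesValue, coeff_mk, hK.zero] at h1
  simp at h1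

theorem seriesValue_linProd {K : ℕ → MvPolynomial ℕ+ ℚ} (hK : IsMultiplicativeSequence K)
    (t : Multiset ℂ) : seriesValue K (linProd t) =
      (t.map fun a => rescale a ((charSeries K).map (algebraMap ℚ ℂ))).prod := by
  induction t using Multiset.induction_on with
  | empty =>
    simpa [linProd] using seriesValue_one hK
  | cons a t ih =>
    have h : linProd (a ::ₘ t) = (1 + C a * X) * linProd t := by
      rw [linProd, Multiset.map_cons, Multiset.prod_cons, linProd]
    rw [h, Multiset.map_cons, Multiset.prod_cons, hK.mul ℂ _ _ (by simp)
      (constantCoeff_linProd t), ← ih, seriesValue_one_add_C_mul_X hK]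

theorem IsMultiplicativeSequence.eq_of_charSeries_eq {K K' : ℕ → MvPolynomial ℕ+ ℚ}
    (hK : IsMultiplicativeSequence K) (hK' : IsMultiplicativeSequence K')
    (h : charSeries K = charSeries K') : K = K' := by
  funext k
  refine MvPolynomial.map_injective (algebraMap ℚ ℂ) (algebraMap ℚ ℂ).injective ?_
  refine eq_of_eval_linProd_eq (isWeightedHomogeneous_map _ (hK.homogeneous k)) (isWeightedHomogeneous_map _ (hK'.homogeneous k)) fun t => ?_
  rw [eval_map_eq_coeff_seriesValue, eval_map_eq_coeff_seriesValue, seriesValue_linProd hK,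
    seriesValue_linProd hK', h]

end AHat

/-! ### Euler's product for sinh, coefficient by coefficient. -/

namespace AHat

open PowerSeries Filter Topology

/-- `1 / (2 π (n + 1)) ^ 2`. -/
noncomputable def sinhRoot (n : ℕ) : ℝ := 1 / (2 * Real.pi * ((n : ℝ) + 1)) ^ 2

theorem sinhRoot_pos (n : ℕ) : 0 < sinhRoot n := by
  have := Real.pi_pos
  rw [sinhRoot]
  positivity

theorem summable_sinhRoot : Summable sinhRoot := by
  have h := (summable_nat_add_iff 1).2 (Real.summable_one_div_nat_pow.2 (one_lt_two))
  refine (h.mul_left (1 / (2 * Real.pi) ^ 2)).congr fun n => ?_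
  push_cast
  rw [sinhRoot, one_div_mul_one_div, ← mul_pow]

/-- The partial product `∏_{n < N} (1 + z / (2 π (n + 1)) ^ 2)`. -/
noncomputable def sinhPartial (N : ℕ) : Polynomial ℝ :=
  ∏ n ∈ Finset.range N, (1 + Polynomial.C (sinhRoot n) * Polynomial.X)

theorem sinhPartial_succ (N m : ℕ) : (sinhPartial (N + 1)).coeff (m + 1) =
    (sinhPartial N).coeff (m + 1) + sinhRoot N * (sinhPartial N).coeff m := by
  rw [sinhPartial, Finset.prod_range_succ, ← sinhPartial, mul_add, mul_one, Polynomial.coeff_add,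
    mul_left_comm, Polynomial.coeff_C_mul, Polynomial.coeff_mul_X]

theorem sinhPartial_coeff_zero (N : ℕ) : (sinhPartial N).coeff 0 = 1 := by
  rw [Polynomial.coeff_zero_eq_eval_zero, sinhPartial, Polynomial.eval_prod]
  simp

theorem sinhPartial_coeff_nonneg (N m : ℕ) : 0 ≤ (sinhPartial N).coeff m := by
  induction N generalizing m with
  | zero => rw [sinhPartial, Finset.prod_range_zero, Polynomial.coeff_one]; positivity
  | succ N ih =>
    rcases m with _ | m
    · rw [sinhPartial_coeff_zero]; exact zero_le_one
    · rw [sinhPartial_succ]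
      have := ih m
      have := ih (m + 1)
      have := (sinhRoot_pos N).le
      positivity

theorem sinhPartial_coeff_mono (m : ℕ) : Monotone fun N => (sinhPartial N).coeff m := by
  refine monotone_nat_of_le_succ fun N => ?_
  rcases m with _ | m
  · simp only [sinhPartial_coeff_zero, le_refl]
  · rw [sinhPartial_succ]
    have := mul_nonneg (sinhRoot_pos N).le (sinhPartial_coeff_nonneg N m)
    linarith

theorem hasSum_sinhPartial (N : ℕ) (z : ℝ) :
    HasSum (fun m => (sinhPartial N).coeff m * z ^ m) ((sinhPartial N).eval z) := by
  rw [Polynomial.eval_eq_sum_range]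
  refine hasSum_sum_of_ne_finset_zero fun m hm => ?_
  rw [Polynomial.coeff_eq_zero_of_natDegree_lt (by simpa [Nat.lt_succ_iff] using hm), zero_mul]

/-- All terms are nonnegative, so one term is at most the whole value, and 1 + x ≤ exp x bounds the
product. The bound is uniform in N and m. -/
theorem sinhPartial_coeff_mul_pow_le (N m : ℕ) {z : ℝ} (hz : 0 ≤ z) :
    (sinhPartial N).coeff m * z ^ m ≤ Real.exp (z * ∑' n, sinhRoot n) := by
  calc (sinhPartial N).coeff m * z ^ m ≤ (sinhPartial N).eval z :=
        le_hasSum (hasSum_sinhPartial N z) m fun i _ =>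
          mul_nonneg (sinhPartial_coeff_nonneg N i) (pow_nonneg hz i)
    _ = ∏ n ∈ Finset.range N, (1 + sinhRoot n * z) := by
        rw [sinhPartial, Polynomial.eval_prod]; simp
    _ ≤ ∏ n ∈ Finset.range N, Real.exp (sinhRoot n * z) := by
        refine Finset.prod_le_prod (fun n _ => ?_) fun n _ => ?_
        · have := mul_nonneg (sinhRoot_pos n).le hz
          positivity
        · rw [add_comm]; exact Real.add_one_le_exp _
    _ = Real.exp (z * ∑ n ∈ Finset.range N, sinhRoot n) := by
        rw [← Real.exp_sum, ← Finset.sum_mul, mul_comm]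
    _ ≤ Real.exp (z * ∑' n, sinhRoot n) := by
        gcongr
        exact summable_sinhRoot.sum_le_tsum _ fun n _ => (sinhRoot_pos n).le

/-- The limits of the coefficients of the partial products. -/
noncomputable def sinhLimit (m : ℕ) : ℝ := ⨆ N, (sinhPartial N).coeff m

theorem tendsto_sinhLimit (m : ℕ) :
    Tendsto (fun N => (sinhPartial N).coeff m) atTop (𝓝 (sinhLimit m)) := by
  refine tendsto_atTop_ciSup (sinhPartial_coeff_mono m) ⟨Real.exp (1 * ∑' n, sinhRoot n), ?_⟩
  rintro _ ⟨N, rfl⟩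
  simpa using sinhPartial_coeff_mul_pow_le N m zero_le_one

theorem norm_sinhPartial_coeff_mul_pow_le (N m : ℕ) (z : ℝ) :
    ‖(sinhPartial N).coeff m * z ^ m‖ ≤
      Real.exp ((2 * |z|) * ∑' n, sinhRoot n) * (1 / 2) ^ m := by
  -- Evaluating at 2|z| leaves a factor 2^{-m}, a summable majorant for dominated convergence.
  have h := sinhPartial_coeff_mul_pow_le N m (z := 2 * |z|) (by positivity)
  rw [norm_mul, Real.norm_of_nonneg (sinhPartial_coeff_nonneg N m), norm_pow, Real.norm_eq_abs]
  calc (sinhPartial N).coeff m * |z| ^ m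
      = (sinhPartial N).coeff m * (2 * |z|) ^ m * (1 / 2) ^ m := by
        rw [mul_assoc, ← mul_pow]; congr 2; ring
    _ ≤ _ := by gcongr

theorem hasSum_sinhLimit (z : ℝ) : HasSum (fun m => sinhLimit m * z ^ m)
    (∑' m, sinhLimit m * z ^ m) := by
  refine Summable.hasSum ?_
  refine Summable.of_norm_bounded (g := fun m => Real.exp ((2 * |z|) * ∑' n, sinhRoot n) *
    (1 / 2) ^ m) (summable_geometric_two.mul_left _) fun m => ?_
  exact le_of_tendsto ((tendsto_sinhLimit m).mul_const (z ^ m)).norm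
    (Eventually.of_forall fun N => norm_sinhPartial_coeff_mul_pow_le N m z)

theorem tendsto_sinhPartial_eval (z : ℝ) :
    Tendsto (fun N => (sinhPartial N).eval z) atTop (𝓝 (∑' m, sinhLimit m * z ^ m)) := by
  simp_rw [← (hasSum_sinhPartial _ z).tsum_eq]
  exact tendsto_tsum_of_dominated_convergence (bound := fun m =>
    Real.exp ((2 * |z|) * ∑' n, sinhRoot n) * (1 / 2) ^ m) (summable_geometric_two.mul_left _)
    (fun m => (tendsto_sinhLimit m).mul_const (z ^ m))
    (Eventually.of_forall fun N m => norm_sinhPartial_coeff_mul_pow_le N m z)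

/-- At z = -4y² the factor 1 + z/(2πn)² becomes Euler's 1 - y²/(πn)². -/
theorem sinhLimit_mul_eq_sin (y : ℝ) :
    y * ∑' m, sinhLimit m * (-4 * y ^ 2) ^ m = Real.sin y := by
  have h1 := Real.tendsto_euler_sin_prod (y / Real.pi)
  have h2 := (tendsto_sinhPartial_eval (-4 * y ^ 2)).const_mul y
  have hpi := Real.pi_ne_zero
  rw [mul_div_cancel₀ _ hpi] at h1
  refine tendsto_nhds_unique h2 (h1.congr fun N => ?_)
  rw [sinhPartial, Polynomial.eval_prod]
  congr 1
  refine Finset.prod_congr rfl fun n _ => ?_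
  have : (n : ℝ) + 1 ≠ 0 := by positivity
  simp only [Polynomial.eval_add, Polynomial.eval_one, Polynomial.eval_mul, Polynomial.eval_C,
    Polynomial.eval_X, sinhRoot]
  field_simp
  ring

theorem hasSum_odd_powers {c : ℕ → ℝ} {y S : ℝ} (h : HasSum (fun m => c m * y ^ (2 * m + 1)) S) :
    HasSum (fun n => y ^ n • (FormalMultilinearSeries.ofScalars ℝ
      fun n => if Odd n then c (n / 2) else 0).coeff n) S := by
  have hi : Function.Injective fun m : ℕ => 2 * m + 1 := fun a b hab => by
    simp only at hab; omega
  refine (hi.hasSum_iff ?_).1 (h.congr_fun fun m => ?_)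
  · intro n hn
    have : ¬ Odd n := fun ⟨m, hm⟩ => hn ⟨m, hm.symm⟩
    rw [FormalMultilinearSeries.coeff_ofScalars, if_neg this, smul_zero]
  · rw [Function.comp_apply, FormalMultilinearSeries.coeff_ofScalars,
      if_pos (odd_two_mul_add_one m), show (2 * m + 1) / 2 = m by omega, smul_eq_mul, mul_comm]

/-- Two power series represent sin at 0, the one from Euler's product and the Taylor series; their
coefficients of y^{2m+1} agree. -/
theorem sinhLimit_eq (m : ℕ) : sinhLimit m = 1 / (4 ^ m * (Nat.factorial (2 * m + 1) : ℝ)) := by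
  have h1 : HasFPowerSeriesAt Real.sin (FormalMultilinearSeries.ofScalars ℝ
      fun n => if Odd n then (-4) ^ (n / 2) * sinhLimit (n / 2) else 0) 0 := by
    refine hasFPowerSeriesAt_iff.2 (Eventually.of_forall fun y => ?_)
    rw [zero_add]
    refine hasSum_odd_powers (c := fun m => (-4) ^ m * sinhLimit m) ?_
    rw [← sinhLimit_mul_eq_sin]
    refine ((hasSum_sinhLimit (-4 * y ^ 2)).mul_left y).congr_fun fun m => ?_
    rw [mul_pow, pow_succ, pow_mul]
    ring
  have h2 : HasFPowerSeriesAt Real.sin (FormalMultilinearSeries.ofScalars ℝ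
      fun n => if Odd n then (-1) ^ (n / 2) / (Nat.factorial (2 * (n / 2) + 1) : ℝ) else 0) 0 := by
    refine hasFPowerSeriesAt_iff.2 (Eventually.of_forall fun y => ?_)
    rw [zero_add]
    refine hasSum_odd_powers (c := fun m => (-1) ^ m / (Nat.factorial (2 * m + 1) : ℝ)) ?_
    exact (Real.hasSum_sin y).congr_fun fun m => by ring
  have h3 := congrArg (fun p => FormalMultilinearSeries.coeff p (2 * m + 1))
    (h1.eq_formalMultilinearSeries h2)
  simp only [FormalMultilinearSeries.coeff_ofScalars] at h3
  rw [if_pos (odd_two_mul_add_one m), if_pos (odd_two_mul_add_one m),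
    show (2 * m + 1) / 2 = m by omega] at h3
  have h4 : ((-4 : ℝ)) ^ m = (-1) ^ m * 4 ^ m := by rw [← mul_pow]; norm_num
  have h5 : ((-1 : ℝ)) ^ m ≠ 0 := by positivity
  rw [h4, mul_assoc, div_eq_mul_one_div, mul_right_inj' h5] at h3
  rw [← div_div, div_right_comm, ← h3]
  field_simp

end AHat

/-! ### Complete symmetric sums as the inverse of a product. -/

namespace AHat

open PowerSeries Filter Topology

section CompleteSums

/-- The positive integers at most `N`. -/
def box (N : ℕ) : Finset ℕ+ := (Finset.range N).image Nat.succPNat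

theorem mem_box {N : ℕ} {n : ℕ+} : n ∈ box N ↔ (n : ℕ) ≤ N := by
  rw [box, Finset.mem_image]
  constructor
  · rintro ⟨a, ha, rfl⟩
    simpa [Nat.succ_le_iff] using ha
  · intro h
    exact ⟨n.natPred, Finset.mem_range.2 (by have := n.natPred_add_one; omega),
      PNat.succPNat_natPred n⟩

open Classical in
/-- The sequences `N ≥ n_1 ≥ ⋯ ≥ n_r ≥ 1`. -/
noncomputable def antitoneWords (r N : ℕ) : Finset (Fin r → ℕ+) :=
  (Fintype.piFinset fun _ => box N).filter Antitone

theorem mem_antitoneWords {r N : ℕ} {n : Fin r → ℕ+} :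
    n ∈ antitoneWords r N ↔ (∀ i, (n i : ℕ) ≤ N) ∧ Antitone n := by
  simp [antitoneWords, mem_box]

/-- The complete homogeneous symmetric sum `∑ u_{n_1} ⋯ u_{n_r}` over
`N ≥ n_1 ≥ ⋯ ≥ n_r ≥ 1`. -/
noncomputable def completeSum {A : Type*} [CommRing A] (u : ℕ+ → A) (r N : ℕ) : A :=
  ∑ n ∈ antitoneWords r N, ∏ i, u (n i)

variable {A : Type*} [CommRing A] (u : ℕ+ → A)

theorem completeSum_zero_left (N : ℕ) : completeSum u 0 N = 1 := by
  have : antitoneWords 0 N = Finset.univ := by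
    ext n
    simp [mem_antitoneWords, Subsingleton.antitone, eq_iff_true_of_subsingleton]
  simp [completeSum, this]

theorem completeSum_zero_right (r : ℕ) : completeSum u (r + 1) 0 = 0 := by
  refine Finset.sum_eq_zero fun n hn => ?_
  have := (mem_antitoneWords.1 hn).1 0
  have := (n 0).pos
  omega

theorem antitone_cons {r : ℕ} {a : ℕ+} {n : Fin r → ℕ+} :
    Antitone (Fin.cons a n : Fin (r + 1) → ℕ+) ↔ (∀ i, n i ≤ a) ∧ Antitone n := by
  constructor
  · intro h
    refine ⟨fun i => ?_, fun i j hij => ?_⟩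
    · simpa using h (Fin.zero_le i.succ)
    · simpa using h (Fin.succ_le_succ_iff.2 hij)
  · rintro ⟨h, hn⟩ i j hij
    induction i using Fin.cases with
    | zero =>
      induction j using Fin.cases with
      | zero => exact le_rfl
      | succ j => simpa using h j
    | succ i =>
      induction j using Fin.cases with
      | zero => simp at hij
      | succ j => simpa using hn (Fin.succ_le_succ_iff.1 hij)

/-- Split according to whether the largest entry n_1 equals N + 1; if so, it is removed. -/
theorem completeSum_succ (r N : ℕ) : completeSum u (r + 1) (N + 1) =
    completeSum u (r + 1) N + u N.succPNat * completeSum u r (N + 1) := by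
  classical
  rw [completeSum, ← Finset.sum_filter_not_add_sum_filter _ fun n => n 0 = N.succPNat]
  congr 1
  · rw [completeSum]
    refine Finset.sum_congr ?_ fun _ _ => rfl
    ext n
    rw [Finset.mem_filter, mem_antitoneWords, mem_antitoneWords]
    constructor
    · rintro ⟨⟨h1, h2⟩, h3⟩
      refine ⟨fun i => ?_, h2⟩
      have h4 : (n i : ℕ) ≤ n 0 := h2 (Fin.zero_le i)
      have h5 : (n 0 : ℕ) ≠ N + 1 := fun h => h3 (PNat.eq h)
      have := h1 0
      omega
    · rintro ⟨h1, h2⟩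
      refine ⟨⟨fun i => (h1 i).trans N.le_succ, h2⟩, fun h => ?_⟩
      have := h1 0
      rw [h] at this
      simp at this
  · rw [completeSum, Finset.mul_sum]
    symm
    refine Finset.sum_bij' (fun n _ => Fin.cons N.succPNat n) (fun n _ => Fin.tail n) ?_ ?_ ?_ ?_ ?_
    · intro n hn
      rw [mem_antitoneWords] at hn
      rw [Finset.mem_filter, mem_antitoneWords, antitone_cons]
      refine ⟨⟨fun i => ?_, fun i => hn.1 i, hn.2⟩, rfl⟩
      induction i using Fin.cases with
      | zero => simp
      | succ i => simpa using hn.1 i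
    · intro n hn
      rw [Finset.mem_filter, mem_antitoneWords] at hn
      rw [mem_antitoneWords]
      exact ⟨fun i => hn.1.1 i.succ, fun i j hij => hn.1.2 (Fin.succ_le_succ_iff.2 hij)⟩
    · intro n _
      exact Fin.tail_cons _ _
    · intro n hn
      rw [Finset.mem_filter] at hn
      rw [← hn.2]
      exact Fin.cons_self_tail n
    · intro n _
      rw [Fin.prod_univ_succ]
      simp

/-- The truncated alternating sum `∑_{r ≤ K} (-1) ^ r h_r`. -/
noncomputable def alternatingSum (K N : ℕ) : A :=
  ∑ r ∈ Finset.range (K + 1), (-1) ^ r * completeSum u r N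

/-- A truncated form of ∑ (-1)^r h_r = ∏ (1 + u_n)⁻¹: the recursion telescopes and only the term of
top degree survives. When X divides every u_n, that term is divisible by X^{K+1}. -/
theorem alternatingSum_succ_mul (K N : ℕ) :
    alternatingSum u K (N + 1) * (1 + u N.succPNat) =
      alternatingSum u K N + (-1) ^ K * (u N.succPNat * completeSum u K (N + 1)) := by
  induction K with
  | zero => simp [alternatingSum, completeSum_zero_left]
  | succ K ih =>
    have h : ∀ N, alternatingSum u (K + 1) N =
        alternatingSum u K N + (-1) ^ (K + 1) * completeSum u (K + 1) N := fun N =>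
      Finset.sum_range_succ _ _
    have h1 := completeSum_succ u K N
    rw [h, h, add_mul, ih, pow_succ]
    linear_combination (-(-1) ^ K) * h1

end CompleteSums

section Truncation

variable {R : Type*} [CommRing R]

theorem X_pow_dvd_completeSum {u : ℕ+ → PowerSeries R} (hu : ∀ n, X ∣ u n) (r N : ℕ) :
    X ^ r ∣ completeSum u r N := by
  refine Finset.dvd_sum fun n _ => ?_
  have := Finset.prod_dvd_prod_of_dvd (s := (Finset.univ : Finset (Fin r))) (fun _ => X)
    (fun i => u (n i)) fun i _ => hu (n i)
  simpa using this

theorem X_pow_dvd_alternatingSum_mul_sub_one {u : ℕ+ → PowerSeries R} (hu : ∀ n, X ∣ u n)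
    (K N : ℕ) : X ^ (K + 1) ∣
      alternatingSum u K N * ∏ n ∈ Finset.range N, (1 + u n.succPNat) - 1 := by
  induction N with
  | zero =>
    have : alternatingSum u K 0 = 1 := by
      rw [alternatingSum, Finset.sum_range_succ']
      simp [completeSum_zero_left, completeSum_zero_right]
    simp [this]
  | succ N ih =>
    have h1 := alternatingSum_succ_mul u K N
    have h2 : X ^ (K + 1) ∣ u N.succPNat * completeSum u K (N + 1) := by
      rw [pow_succ']
      exact mul_dvd_mul (hu _) (X_pow_dvd_completeSum hu K (N + 1))
    have h3 : alternatingSum u K (N + 1) * ∏ n ∈ Finset.range (N + 1), (1 + u n.succPNat) - 1 =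
        (alternatingSum u K N * ∏ n ∈ Finset.range N, (1 + u n.succPNat) - 1) +
          u N.succPNat * completeSum u K (N + 1) *
            ((-1) ^ K * ∏ n ∈ Finset.range N, (1 + u n.succPNat)) := by
      rw [Finset.prod_range_succ]
      linear_combination (∏ n ∈ Finset.range N, (1 + u n.succPNat)) * h1
    rw [h3]
    exact dvd_add ih (h2.mul_right _)

end Truncation

section Coefficients

/-- The sequences of `r` positive integers with sum `k`. -/
def compositions (r k : ℕ) : Finset (Fin r → ℕ+) :=
  (Fintype.piFinset fun _ => box k).filter fun c => ∑ i, (c i : ℕ) = k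

theorem mem_compositions {r k : ℕ} {c : Fin r → ℕ+} :
    c ∈ compositions r k ↔ ∑ i, (c i : ℕ) = k := by
  rw [compositions, Finset.mem_filter, and_iff_right_iff_imp]
  rintro rfl
  rw [Fintype.mem_piFinset]
  exact fun i => mem_box.2
    (Finset.single_le_sum (f := fun i => (c i : ℕ)) (fun _ _ => Nat.zero_le _) (Finset.mem_univ i))

theorem coeff_prod_of_X_dvd {R : Type*} [CommRing R] {r : ℕ} {f : Fin r → PowerSeries R}
    (hf : ∀ i, X ∣ f i) (k : ℕ) :
    coeff k (∏ i, f i) = ∑ c ∈ compositions r k, ∏ i, coeff (c i : ℕ) (f i) := by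
  rw [coeff_prod]
  symm
  refine Finset.sum_of_injOn (fun c => Finsupp.equivFunOnFinite.symm fun i => (c i : ℕ)) ?_ ?_ ?_ ?_
  · intro c _ c' _ h
    funext i
    have := DFunLike.congr_fun h i
    exact PNat.eq (by simpa using this)
  · intro c hc
    rw [Finset.mem_coe, mem_compositions] at hc
    rw [Finset.mem_coe, Finset.mem_finsuppAntidiag]
    exact ⟨by simpa using hc, Finset.subset_univ _⟩
  · intro l hl hl'
    rw [Finset.mem_finsuppAntidiag] at hl
    by_contra h
    -- An exponent 0 picks a constant coefficient, which vanishes, so only genuine compositions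
    -- contribute.
    have hpos : ∀ i, 0 < l i := by
      intro i
      by_contra hi
      refine h (Finset.prod_eq_zero (Finset.mem_univ i) ?_)
      rw [show l i = 0 by omega, coeff_zero_eq_constantCoeff_apply, X_dvd_iff.1 (hf i)]
    refine hl' ⟨fun i => (⟨l i, hpos i⟩ : ℕ+), ?_, ?_⟩
    · exact Finset.mem_coe.2 (mem_compositions.2 hl.1)
    · ext i
      rfl
  · intro c _
    rfl

end Coefficients

/-! ### Convergence of the sums S. -/

section Convergence

/-- A finite set of index tuples lies in the product of its projections, where the sum factors. -/
theorem summable_prod_apply {r : ℕ} {g : Fin r → ℕ+ → ℝ} (h0 : ∀ i n, 0 ≤ g i n)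
    (hg : ∀ i, Summable (g i)) : Summable fun n : Fin r → ℕ+ => ∏ i, g i (n i) := by
  classical
  refine summable_of_sum_le (c := ∏ i, ∑' n, g i n)
    (fun n => Finset.prod_nonneg fun i _ => h0 i _) fun s => ?_
  calc ∑ n ∈ s, ∏ i, g i (n i)
      ≤ ∑ n ∈ Fintype.piFinset fun i => s.image fun n => n i, ∏ i, g i (n i) := by
        refine Finset.sum_le_sum_of_subset_of_nonneg (fun n hn => ?_)
          fun n _ _ => Finset.prod_nonneg fun i _ => h0 i _
        exact Fintype.mem_piFinset.2 fun i => Finset.mem_image_of_mem (fun n => n i) hn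
    _ = ∏ i, ∑ n ∈ s.image fun n => n i, g i n := (Finset.prod_univ_sum _ _).symm
    _ ≤ ∏ i, ∑' n, g i n := Finset.prod_le_prod (fun i _ => Finset.sum_nonneg fun n _ => h0 i n)
        fun i _ => (hg i).sum_le_tsum _ fun n _ => h0 i n

theorem starTerm_eq_prod {r : ℕ} (s : Fin r → ℝ) (n : {n : Fin r → ℕ+ // Antitone n}) :
    starTerm s n = ∏ i, 1 / ((n.1 i : ℕ) : ℝ) ^ s i := by
  rw [starTerm, Finset.prod_div_distrib, Finset.prod_const_one]

theorem starTerm_pos {r : ℕ} (s : Fin r → ℝ) (n : {n : Fin r → ℕ+ // Antitone n}) :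
    0 < starTerm s n := by
  rw [starTerm_eq_prod]
  refine Finset.prod_pos fun i _ => ?_
  have : (0 : ℝ) < ((n.1 i : ℕ) : ℝ) := by exact_mod_cast (n.1 i).pos
  positivity

theorem summable_starTerm {r : ℕ} {s : Fin r → ℝ} (hs : ∀ i, 1 < s i) :
    Summable (starTerm s) := by
  have h := summable_prod_apply (g := fun i (n : ℕ+) => 1 / ((n : ℕ) : ℝ) ^ s i)
    (fun i n => by positivity) fun i =>
      (Real.summable_one_div_nat_rpow.2 (hs i)).comp_injective PNat.coe_injective
  exact (h.comp_injective Subtype.val_injective).congr fun n => (starTerm_eq_prod s n).symm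

theorem starSum_pos {r : ℕ} {s : Fin r → ℝ} (hs : ∀ i, 1 < s i) : 0 < starSum s :=
  (summable_starTerm hs).tsum_pos (fun n => (starTerm_pos s n).le) ⟨fun _ => 1, antitone_const⟩
    (starTerm_pos s _)

theorem one_lt_two_mul_pnat (c : ℕ+) : 1 < 2 * ((c : ℕ) : ℝ) := by
  have : (1 : ℝ) ≤ ((c : ℕ) : ℝ) := by exact_mod_cast c.pos
  linarith

/-- The partial sum of `∑ x_{n_1} ^ {c_1} ⋯ x_{n_r} ^ {c_r}` for `x_n = 1 / (2 π n) ^ 2`. -/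
noncomputable def starPartial {r : ℕ} (c : Fin r → ℕ+) (N : ℕ) : ℝ :=
  ∑ n ∈ antitoneWords r N, ∏ i, sinhRoot (n i).natPred ^ (c i : ℕ)

theorem sinhRoot_natPred (n : ℕ+) :
    sinhRoot n.natPred = 1 / (2 * Real.pi) ^ 2 * (1 / ((n : ℕ) : ℝ) ^ 2) := by
  have : ((n.natPred : ℕ) : ℝ) + 1 = ((n : ℕ) : ℝ) := by exact_mod_cast n.natPred_add_one
  rw [sinhRoot, this, one_div_mul_one_div, ← mul_pow]

theorem tendsto_starPartial {r : ℕ} (c : Fin r → ℕ+) :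
    Tendsto (starPartial c) atTop (𝓝 (1 / (2 * Real.pi) ^ (2 * ∑ i, (c i : ℕ)) *
      starSum fun i => 2 * ((c i : ℕ) : ℝ))) := by
  classical
  have h := (summable_starTerm fun i => one_lt_two_mul_pnat (c i)).hasSum
  have hW : Tendsto (fun N => (Fintype.piFinset fun _ : Fin r => box N).subtype Antitone)
      atTop atTop := by
    refine tendsto_atTop_finset_of_monotone (fun N M hNM => ?_) fun n => ?_
    · intro n hn
      rw [Finset.mem_subtype, Fintype.mem_piFinset] at hn ⊢
      exact fun i => mem_box.2 ((mem_box.1 (hn i)).trans hNM)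
    · refine ⟨∑ i, (n.1 i : ℕ), ?_⟩
      rw [Finset.mem_subtype, Fintype.mem_piFinset]
      exact fun i => mem_box.2 (Finset.single_le_sum (f := fun i => (n.1 i : ℕ))
        (fun _ _ => Nat.zero_le _) (Finset.mem_univ i))
  refine ((h.comp hW).const_mul _).congr fun N => ?_
  rw [Function.comp_apply, starPartial, antitoneWords, ← Finset.sum_subtype_eq_sum_filter,
    Finset.mul_sum]
  refine Finset.sum_congr rfl fun n _ => ?_
  rw [starTerm_eq_prod, Finset.mul_sum, ← Finset.prod_pow_eq_pow_sum]
  simp_rw [one_div]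
  rw [← Finset.prod_inv_distrib, ← Finset.prod_mul_distrib]
  refine Finset.prod_congr rfl fun i _ => ?_
  have : (2 * ((c i : ℕ) : ℝ)) = ((2 * (c i : ℕ) : ℕ) : ℝ) := by push_cast; rfl
  rw [sinhRoot_natPred, this, Real.rpow_natCast, pow_mul, pow_mul]
  simp [mul_pow]

end Convergence

end AHat

/-! ### Identification of the Â-polynomials. -/

namespace AHat

open PowerSeries Filter Topology

/-- The value `∑ x_{n_1} ^ {c_1} ⋯ x_{n_r} ^ {c_r}` for `x_n = 1 / (2 π n) ^ 2`, the sum being over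
`n_1 ≥ ⋯ ≥ n_r ≥ 1`. -/
noncomputable def starValue {r : ℕ} (c : Fin r → ℕ+) : ℝ :=
  1 / (2 * Real.pi) ^ (2 * ∑ i, (c i : ℕ)) * starSum fun i => 2 * ((c i : ℕ) : ℝ)

/-- The exponent of the monomial `p_{c_1} ⋯ p_{c_r}`. -/
noncomputable def content {r : ℕ} (c : Fin r → ℕ+) : ℕ+ →₀ ℕ := ∑ i, Finsupp.single (c i) 1

/-- The polynomial `∑ (-1) ^ r S(c) p_{c_1} ⋯ p_{c_r}` over the compositions `c` of `k`. -/
noncomputable def starPoly (k : ℕ) : MvPolynomial ℕ+ ℝ :=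
  ∑ r ∈ Finset.range (k + 1), ∑ c ∈ compositions r k,
    MvPolynomial.monomial (content c) ((-1) ^ r * starValue c)

theorem weight_content {r : ℕ} (c : Fin r → ℕ+) :
    Finsupp.weight (fun i : ℕ+ => (i : ℕ)) (content c) = ∑ i, (c i : ℕ) := by
  rw [content, map_sum]
  simp [Finsupp.weight_single]

theorem isWeightedHomogeneous_starPoly (k : ℕ) :
    (starPoly k).IsWeightedHomogeneous (fun i : ℕ+ => (i : ℕ)) k := by
  refine MvPolynomial.IsWeightedHomogeneous.sum _ _ _ fun r _ =>
    MvPolynomial.IsWeightedHomogeneous.sum _ _ _ fun c hc => ?_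
  exact MvPolynomial.isWeightedHomogeneous_monomial _ _ _
    ((weight_content c).trans (mem_compositions.1 hc))

theorem eval_map_starPoly (k : ℕ) (p : ℕ+ → ℂ) :
    MvPolynomial.eval p ((starPoly k).map (algebraMap ℝ ℂ)) =
      ∑ r ∈ Finset.range (k + 1), ∑ c ∈ compositions r k,
        (-1) ^ r * ((∏ i, p (c i)) * (starValue c : ℂ)) := by
  rw [starPoly]
  simp only [map_sum]
  refine Finset.sum_congr rfl fun r _ => Finset.sum_congr rfl fun c _ => ?_
  have h : (content c).prod (fun n e => p n ^ e) = ∏ i, p (c i) := by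
    rw [content, ← Finsupp.prod_finsetSum_index (fun _ => pow_zero _) fun _ _ _ => pow_add _ _ _]
    simp
  rw [MvPolynomial.map_monomial, MvPolynomial.eval_monomial, h]
  simp
  ring

/-- The differences `P(x_n z) - 1` for `x_n = 1 / (2 π n) ^ 2`. -/
noncomputable def scaledDiff (P : PowerSeries ℂ) (n : ℕ+) : PowerSeries ℂ :=
  rescale (sinhRoot n.natPred : ℂ) P - 1

theorem X_dvd_scaledDiff {P : PowerSeries ℂ} (hP : constantCoeff P = 1) (n : ℕ+) :
    X ∣ scaledDiff P n := by
  rw [X_dvd_iff, scaledDiff, map_sub, ← coeff_zero_eq_constantCoeff_apply, coeff_rescale,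
    coeff_zero_eq_constantCoeff_apply, hP]
  simp

theorem coeff_scaledDiff (P : PowerSeries ℂ) (n c : ℕ+) :
    coeff (c : ℕ) (scaledDiff P n) = (sinhRoot n.natPred : ℂ) ^ (c : ℕ) * coeff (c : ℕ) P := by
  rw [scaledDiff, map_sub, coeff_rescale, coeff_one, if_neg c.ne_zero, sub_zero]

theorem coeff_alternatingSum_scaledDiff {P : PowerSeries ℂ} (hP : constantCoeff P = 1)
    (m K N : ℕ) : coeff m (alternatingSum (scaledDiff P) K N) =
      ∑ r ∈ Finset.range (K + 1), ∑ c ∈ compositions r m,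
        (-1) ^ r * ((∏ i, coeff (c i : ℕ) P) * (starPartial c N : ℂ)) := by
  rw [alternatingSum, map_sum]
  refine Finset.sum_congr rfl fun r _ => ?_
  have h1 : ((-1 : PowerSeries ℂ)) ^ r = C ((-1) ^ r) := by simp
  rw [h1, coeff_C_mul, ← Finset.mul_sum, completeSum, map_sum]
  simp_rw [coeff_prod_of_X_dvd (fun i => X_dvd_scaledDiff hP _), coeff_scaledDiff]
  rw [Finset.sum_comm]
  congr 1
  refine Finset.sum_congr rfl fun c _ => ?_
  rw [starPartial, Complex.ofReal_sum, Finset.mul_sum]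
  refine Finset.sum_congr rfl fun n _ => ?_
  rw [Finset.prod_mul_distrib, mul_comm]
  push_cast
  rfl

/-- Coefficientwise convergence of power series is compatible with products. -/
theorem tendsto_coeff_mul {F G : ℕ → PowerSeries ℂ} {f g : PowerSeries ℂ}
    (hF : ∀ m, Tendsto (fun N => coeff m (F N)) atTop (𝓝 (coeff m f)))
    (hG : ∀ m, Tendsto (fun N => coeff m (G N)) atTop (𝓝 (coeff m g))) (m : ℕ) :
    Tendsto (fun N => coeff m (F N * G N)) atTop (𝓝 (coeff m (f * g))) := by
  simp_rw [coeff_mul]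
  exact tendsto_finsetSum _ fun i _ => (hF i.1).mul (hG i.2)

/-- The power series `sinh (√z / 2) / (√z / 2)`. -/
noncomputable def sinhSeries : PowerSeries ℚ :=
  mk fun n => 1 / ((4 : ℚ) ^ n * (Nat.factorial (2 * n + 1) : ℚ))

theorem constantCoeff_sinhSeries : constantCoeff sinhSeries = 1 := by
  rw [← coeff_zero_eq_constantCoeff_apply, sinhSeries, coeff_mk]
  simp

theorem sinhSeries_mul_aHatSeries : sinhSeries * aHatSeries = 1 :=
  PowerSeries.mul_inv_cancel _ (by
    change constantCoeff sinhSeries ≠ 0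
    rw [constantCoeff_sinhSeries]
    exact one_ne_zero)

theorem constantCoeff_aHatSeries : constantCoeff aHatSeries = 1 := by
  have := congrArg constantCoeff sinhSeries_mul_aHatSeries
  rwa [map_mul, constantCoeff_sinhSeries, one_mul, map_one] at this

theorem rescale_linProd (x : ℂ) (t : Multiset ℂ) :
    rescale x (linProd t) = (t.map fun a => 1 + C (x * a) * X).prod := by
  rw [linProd, map_multiset_prod, Multiset.map_map]
  congr 1
  refine Multiset.map_congr rfl fun a _ => ?_
  ext n
  simp only [Function.comp_apply, coeff_rescale, map_add, coeff_one, coeff_C_mul, coeff_X]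
  rcases n with _ | _ | n <;> simp

theorem prod_rescale_linProd (N : ℕ) (t : Multiset ℂ) :
    ∏ n ∈ Finset.range N, rescale (sinhRoot n : ℂ) (linProd t) =
      (t.map fun a => rescale a
        (((sinhPartial N : Polynomial ℝ) : PowerSeries ℝ).map (algebraMap ℝ ℂ))).prod := by
  have h : ∀ a : ℂ, rescale a
      (((sinhPartial N : Polynomial ℝ) : PowerSeries ℝ).map (algebraMap ℝ ℂ)) =
        ∏ n ∈ Finset.range N, (1 + C ((sinhRoot n : ℂ) * a) * X) := by
    intro a
    rw [sinhPartial, ← Polynomial.coeToPowerSeries.ringHom_apply, map_prod, map_prod, map_prod]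
    refine Finset.prod_congr rfl fun n _ => ?_
    ext m
    simp only [Polynomial.coeToPowerSeries.ringHom_apply, coeff_rescale, coeff_map,
      Polynomial.coeff_coe, map_add, coeff_one, coeff_C_mul, coeff_X,
      Polynomial.coeff_one, Polynomial.coeff_C_mul, Polynomial.coeff_X]
    rcases m with _ | _ | m <;> simp [mul_comm]
  simp_rw [h, rescale_linProd]
  exact Multiset.prod_map_prod.symm

/-- Interchanging the two finite products turns ∏_n P(x_n z) into one partial Euler product in a z
for each factor 1 + a z of P. -/
theorem tendsto_coeff_prod_rescale_linProd (t : Multiset ℂ) (m : ℕ) :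
    Tendsto (fun N => coeff m (∏ n ∈ Finset.range N, rescale (sinhRoot n : ℂ) (linProd t))) atTop
      (𝓝 (coeff m (t.map fun a => rescale a (sinhSeries.map (algebraMap ℚ ℂ))).prod)) := by
  simp_rw [prod_rescale_linProd]
  induction t using Multiset.induction_on generalizing m with
  | empty => simp
  | cons a t ih =>
    simp_rw [Multiset.map_cons, Multiset.prod_cons]
    refine tendsto_coeff_mul (fun m => ?_) ih m
    simp_rw [coeff_rescale, coeff_map, Polynomial.coeff_coe]
    refine Tendsto.const_mul _ ?_
    have h := (Complex.continuous_ofReal.tendsto _).comp (tendsto_sinhLimit m)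
    rw [sinhLimit_eq] at h
    have hm : algebraMap ℚ ℂ (coeff m sinhSeries) =
        ((1 / (4 ^ m * (Nat.factorial (2 * m + 1) : ℝ)) : ℝ) : ℂ) := by
      rw [sinhSeries, coeff_mk]
      simp
    rw [hm]
    exact h

theorem eval_map_starPoly_linProd (t : Multiset ℂ) (k : ℕ) :
    MvPolynomial.eval (fun i : ℕ+ => coeff (i : ℕ) (linProd t))
        ((starPoly k).map (algebraMap ℝ ℂ)) =
      coeff k (t.map fun a => rescale a (aHatSeries.map (algebraMap ℚ ℂ))).prod := by
  set P := linProd t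
  have hP : constantCoeff P = 1 := constantCoeff_linProd t
  set E := (t.map fun a => rescale a (sinhSeries.map (algebraMap ℚ ℂ))).prod with hE
  set V := (t.map fun a => rescale a (aHatSeries.map (algebraMap ℚ ℂ))).prod with hV
  have hEV : E * V = 1 := by
    rw [hE, hV, ← Multiset.prod_map_mul]
    simp_rw [← map_mul, sinhSeries_mul_aHatSeries]
    simp
  -- The limit of the alternating sums. The range of r stays cut at k in every degree, so G inverts
  -- E only modulo X^{k+1}, which suffices for the coefficient at k.
  let G : PowerSeries ℂ := mk fun m => ∑ r ∈ Finset.range (k + 1), ∑ c ∈ compositions r m,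
    (-1) ^ r * ((∏ i, coeff (c i : ℕ) P) * (starValue c : ℂ))
  have hG : ∀ m, Tendsto (fun N => coeff m (alternatingSum (scaledDiff P) k N)) atTop
      (𝓝 (coeff m G)) := by
    intro m
    simp_rw [coeff_alternatingSum_scaledDiff hP]
    rw [coeff_mk]
    refine tendsto_finsetSum _ fun r _ => tendsto_finsetSum _ fun c _ => ?_
    exact (((Complex.continuous_ofReal.tendsto _).comp (tendsto_starPartial c)).const_mul
      _).const_mul _
  have hGE : X ^ (k + 1) ∣ G * E - 1 := by
    rw [X_pow_dvd_iff]
    intro m hm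
    have h1 := tendsto_coeff_mul hG (tendsto_coeff_prod_rescale_linProd t) m
    rw [map_sub, sub_eq_zero]
    refine tendsto_nhds_unique h1 (tendsto_const_nhds.congr fun N => ?_)
    have h2 := X_pow_dvd_iff.1
      (X_pow_dvd_alternatingSum_mul_sub_one (X_dvd_scaledDiff hP) k N) m hm
    rw [map_sub, sub_eq_zero] at h2
    rw [← h2]
    simp [scaledDiff, P]
  have hGV : X ^ (k + 1) ∣ G - V := by
    have : G - V = (G * E - 1) * V := by linear_combination (-G) * hEV
    rw [this]
    exact hGE.mul_right V
  have h := X_pow_dvd_iff.1 hGV k k.lt_succ_self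
  rw [map_sub, sub_eq_zero, coeff_mk] at h
  rw [eval_map_starPoly, h]

theorem IsAHatSequence.map_eq_starPoly {A : ℕ → MvPolynomial ℕ+ ℚ} (hA : IsAHatSequence A)
    (k : ℕ) : (A k).map (algebraMap ℚ ℝ) = starPoly k := by
  refine MvPolynomial.map_injective (algebraMap ℝ ℂ) (algebraMap ℝ ℂ).injective ?_
  rw [MvPolynomial.map_map, ← IsScalarTower.algebraMap_eq]
  refine eq_of_eval_linProd_eq (isWeightedHomogeneous_map _ (hA.1.homogeneous k))
    (isWeightedHomogeneous_map _ (isWeightedHomogeneous_starPoly k)) fun t => ?_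
  rw [eval_map_eq_coeff_seriesValue, seriesValue_linProd hA.1, hA.2, eval_map_starPoly_linProd]

end AHat

/-! ### Counting rearrangements, and the coefficient formula. -/

namespace AHat

theorem content_apply {r : ℕ} (c : Fin r → ℕ+) (l : ℕ+) :
    content c l = Fintype.card {i // c i = l} := by
  classical
  rw [content, Finsupp.finsetSum_apply, Fintype.card_subtype]
  simp [Finsupp.single_apply]

theorem degree_content {r : ℕ} (c : Fin r → ℕ+) : (content c).degree = r := by
  rw [content, map_sum]
  simp

/-- Equal contents mean fibres of equal size; bijections between the fibres glue to a permutation.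
-/
theorem exists_perm_of_content_eq {r : ℕ} {c j : Fin r → ℕ+} (h : content c = content j) :
    ∃ σ : Equiv.Perm (Fin r), j ∘ σ = c := by
  have e : ∀ l, {i // c i = l} ≃ {i // j i = l} := fun l =>
    Fintype.equivOfCardEq (by rw [← content_apply, ← content_apply, h])
  exact ⟨Equiv.ofFiberEquiv e, funext fun i => Equiv.ofFiberEquiv_map e i⟩

theorem content_comp_perm {r : ℕ} (j : Fin r → ℕ+) (σ : Equiv.Perm (Fin r)) :
    content (j ∘ σ) = content j :=
  Equiv.sum_comp σ fun i => Finsupp.single (j i) 1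

theorem card_stabilizer {r : ℕ} (j : Fin r → ℕ+) {k : ℕ} (hk : ∑ i, (j i : ℕ) = k) :
    (Finset.univ.filter fun σ : Equiv.Perm (Fin r) => j ∘ σ = j).card =
      ∏ l ∈ Finset.Icc 1 k, Nat.factorial (multiplicity j l) := by
  have h := DomMulAct.stabilizer_card' (f := j)
  rw [Fintype.card_subtype] at h
  rw [h]
  -- The stabilizer formula runs over the values of j only; the remaining l ≤ k contribute 0! = 1.
  refine Finset.prod_of_injOn (fun l : ℕ+ => (l : ℕ)) (fun a _ b _ hab => PNat.eq hab) ?_ ?_ ?_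
  · intro l hl
    obtain ⟨i, -, rfl⟩ := Finset.mem_image.1 (Finset.mem_coe.1 hl)
    rw [Finset.mem_coe, Finset.mem_Icc, ← hk]
    exact ⟨(j i).pos, Finset.single_le_sum (f := fun i => (j i : ℕ)) (fun _ _ => Nat.zero_le _)
      (Finset.mem_univ i)⟩
  · intro l _ hl
    have : multiplicity j l = 0 := by
      refine Finset.card_eq_zero.2 (Finset.filter_eq_empty_iff.2 fun i _ hi => hl ?_)
      exact ⟨j i, Finset.mem_coe.2 (Finset.mem_image_of_mem _ (Finset.mem_univ i)), hi⟩
    rw [this, Nat.factorial_zero]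
  · intro l _
    rw [Fintype.card_subtype, multiplicity]
    simp only [PNat.coe_inj]

theorem card_perm_comp_eq {r : ℕ} (j c : Fin r → ℕ+) {k : ℕ} (hk : ∑ i, (j i : ℕ) = k) :
    (Finset.univ.filter fun σ : Equiv.Perm (Fin r) => j ∘ σ = c).card =
      if content c = content j then ∏ l ∈ Finset.Icc 1 k, Nat.factorial (multiplicity j l)
      else 0 := by
  split_ifs with h
  · obtain ⟨τ, rfl⟩ := exists_perm_of_content_eq h
    rw [← card_stabilizer j hk]
    -- The permutations carrying j to j ∘ τ form a coset of the stabilizer of j.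
    refine Finset.card_bij' (fun σ _ => σ * τ⁻¹) (fun σ _ => σ * τ) ?_ ?_ ?_ ?_
    · intro σ hσ
      rw [Finset.mem_filter] at hσ ⊢
      refine ⟨Finset.mem_univ _, funext fun i => ?_⟩
      simpa using congrFun hσ.2 (τ⁻¹ i)
    · intro σ hσ
      rw [Finset.mem_filter] at hσ ⊢
      refine ⟨Finset.mem_univ _, funext fun i => ?_⟩
      simpa using congrFun hσ.2 (τ i)
    · intro σ _
      simp
    · intro σ _
      simp
  · refine Finset.card_eq_zero.2 (Finset.filter_eq_empty_iff.2 fun σ _ hσ => h ?_)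
    rw [← hσ, content_comp_perm]

theorem coeff_starPoly {r : ℕ} (j : Fin r → ℕ+) {k : ℕ} (hk : ∑ i, (j i : ℕ) = k) :
    MvPolynomial.coeff (content j) (starPoly k) =
      (-1) ^ r * ∑ c ∈ compositions r k, if content c = content j then starValue c else 0 := by
  classical
  rw [starPoly, MvPolynomial.coeff_sum, Finset.sum_eq_single_of_mem r]
  · rw [MvPolynomial.coeff_sum, Finset.mul_sum]
    refine Finset.sum_congr rfl fun c _ => ?_
    rw [MvPolynomial.coeff_monomial, mul_ite, mul_zero]
  · rw [Finset.mem_range, ← hk, Nat.lt_succ_iff]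
    calc r = ∑ _i : Fin r, 1 := by simp
      _ ≤ ∑ i, (j i : ℕ) := Finset.sum_le_sum fun i _ => (j i).pos
  -- The content has degree equal to the number of parts, so other lengths never give this monomial.
  · intro r' _ hr
    rw [MvPolynomial.coeff_sum]
    refine Finset.sum_eq_zero fun c _ => ?_
    rw [MvPolynomial.coeff_monomial, if_neg]
    intro h
    have := congrArg Finsupp.degree h
    rw [degree_content, degree_content] at this
    exact hr this

theorem sum_perm_starValue {r : ℕ} (j : Fin r → ℕ+) {k : ℕ} (hk : ∑ i, (j i : ℕ) = k) :
    ∑ σ : Equiv.Perm (Fin r), starValue (j ∘ σ) =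
      (∏ l ∈ Finset.Icc 1 k, (Nat.factorial (multiplicity j l) : ℝ)) *
        ∑ c ∈ compositions r k, if content c = content j then starValue c else 0 := by
  have hmaps : ∀ σ ∈ (Finset.univ : Finset (Equiv.Perm (Fin r))), j ∘ σ ∈ compositions r k :=
    fun σ _ => mem_compositions.2 ((Equiv.sum_comp σ fun i => (j i : ℕ)).trans hk)
  rw [← Finset.sum_fiberwise_of_maps_to hmaps, Finset.mul_sum]
  refine Finset.sum_congr rfl fun c _ => ?_
  rw [Finset.sum_congr rfl fun σ hσ => by rw [(Finset.mem_filter.1 hσ).2], Finset.sum_const,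
    card_perm_comp_eq j c hk]
  split_ifs <;> simp

theorem sum_perm_starValue_eq_symStarSum {r : ℕ} (j : Fin r → ℕ+) {k : ℕ}
    (hk : ∑ i, (j i : ℕ) = k) : ∑ σ : Equiv.Perm (Fin r), starValue (j ∘ σ) =
      1 / (2 * Real.pi) ^ (2 * k) * symStarSum fun i => 2 * ((j i : ℕ) : ℝ) := by
  rw [symStarSum, Finset.mul_sum]
  refine Finset.sum_congr rfl fun σ _ => ?_
  have : ∑ i, ((j ∘ σ) i : ℕ) = k := (Equiv.sum_comp σ fun i => (j i : ℕ)).trans hk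
  rw [starValue, this]
  rfl

theorem symStarSum_pos {r : ℕ} (j : Fin r → ℕ+) :
    0 < symStarSum fun i => 2 * ((j i : ℕ) : ℝ) :=
  Finset.sum_pos (fun σ _ => starSum_pos fun i => one_lt_two_mul_pnat (j (σ i)))
    Finset.univ_nonempty

theorem IsAHatSequence.monomialCoeff_eq {A : ℕ → MvPolynomial ℕ+ ℚ} (hA : IsAHatSequence A)
    {k r : ℕ} (j : Fin r → ℕ+) (hk : ∑ i, (j i : ℕ) = k) :
    (monomialCoeff (A k) j : ℝ) =
      (-1) ^ r / (∏ l ∈ Finset.Icc 1 k, (Nat.factorial (multiplicity j l) : ℝ)) *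
        (1 / (2 * Real.pi) ^ (2 * k)) * symStarSum fun i => 2 * ((j i : ℕ) : ℝ) := by
  have h1 : (monomialCoeff (A k) j : ℝ) = MvPolynomial.coeff (content j) (starPoly k) := by
    rw [← hA.map_eq_starPoly, MvPolynomial.coeff_map]
    rfl
  have h0 : (∏ l ∈ Finset.Icc 1 k, (Nat.factorial (multiplicity j l) : ℝ)) ≠ 0 :=
    Finset.prod_ne_zero_iff.2 fun l _ => by exact_mod_cast Nat.factorial_ne_zero _
  rw [h1, coeff_starPoly j hk, mul_assoc, ← sum_perm_starValue_eq_symStarSum j hk,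
    sum_perm_starValue j hk]
  field_simp

theorem IsAHatSequence.neg_one_pow_mul_monomialCoeff_pos {A : ℕ → MvPolynomial ℕ+ ℚ}
    (hA : IsAHatSequence A) {k r : ℕ} (j : Fin r → ℕ+) (hk : ∑ i, (j i : ℕ) = k) :
    0 < (-1) ^ r * monomialCoeff (A k) j := by
  have h : (0 : ℝ) < (-1) ^ r * (monomialCoeff (A k) j : ℝ) := by
    rw [hA.monomialCoeff_eq j hk, mul_assoc, ← mul_assoc, mul_div_assoc', ← mul_pow]
    have h1 := symStarSum_pos j
    have h2 : 0 < ∏ l ∈ Finset.Icc 1 k, (Nat.factorial (multiplicity j l) : ℝ) :=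
      Finset.prod_pos fun l _ => by exact_mod_cast Nat.factorial_pos _
    have h3 := Real.pi_pos
    norm_num
    positivity
  exact_mod_cast h

theorem existsUnique_isAHatSequence : ∃! A : ℕ → MvPolynomial ℕ+ ℚ, IsAHatSequence A :=
  ⟨multSeq aHatSeries, ⟨isMultiplicativeSequence_multSeq _,
    charSeries_multSeq constantCoeff_aHatSeries⟩, fun _ hA =>
      hA.1.eq_of_charSeries_eq (isMultiplicativeSequence_multSeq _)
        (hA.2.trans (charSeries_multSeq constantCoeff_aHatSeries).symm)⟩

end AHat

theorem theorem4 :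
    (∃! A : ℕ → MvPolynomial ℕ+ ℚ, AHat.IsAHatSequence A) ∧
    ∀ A : ℕ → MvPolynomial ℕ+ ℚ, AHat.IsAHatSequence A →
      ∀ (k r : ℕ) (j : Fin r → ℕ+), Antitone j → ∑ i, (j i : ℕ) = k →
        (∀ σ : Equiv.Perm (Fin r),
          Summable (AHat.starTerm fun i => 2 * ((j (σ i) : ℕ) : ℝ))) ∧
        (AHat.monomialCoeff (A k) j : ℝ) =
          (-1) ^ r / (∏ l ∈ Finset.Icc 1 k, (Nat.factorial (AHat.multiplicity j l) : ℝ)) *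
            (1 / (2 * Real.pi) ^ (2 * k)) *
            AHat.symStarSum (fun i => 2 * ((j i : ℕ) : ℝ)) ∧
        (Odd r → AHat.monomialCoeff (A k) j < 0) ∧
        (Even r → 0 < AHat.monomialCoeff (A k) j) := by
  refine ⟨AHat.existsUnique_isAHatSequence, fun A hA k r j _ hk => ?_⟩
  have h := hA.neg_one_pow_mul_monomialCoeff_pos j hk
  refine ⟨fun σ => AHat.summable_starTerm fun i => AHat.one_lt_two_mul_pnat (j (σ i)),
    hA.monomialCoeff_eq j hk, fun hr => ?_, fun hr => ?_⟩
  · rw [hr.neg_one_pow] at h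
    linarith
  · rwa [hr.neg_one_pow, one_mul] at h
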